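/- For a finite group $G$, let $\Phi(G)$ be its Frattini subgroup, and let the Frattini quotient $G/\Phi(G)$ act by conjugation on the abelian group $Z(\Phi(G))$, the center of $\Phi(G)$. A finite nonabelian $p$-group $G$ ($p$ a prime) is called an NS-group if the zeroth Tate cohomology group vanishes: $$\hat{H}^0\bigl(G/\Phi(G);\, Z(\Phi(G))\bigr) = 0 .$$ Let $G$ be an NS-group of order $2^8$. Then $Z(\Phi(G))$ is isomorphic to $\mathbb{Z}/4 \times (\mathbb{Z}/2)^2$ or to $(\mathbb{Z}/2)^4$. Moreover, $Z(G)$ is contained in $Z(\Phi(G))$, and $Z(\Phi(G))/Z(G) \cong (\mathbb{Z}/2)^3$. -/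

import Mathlib

/-- `Z(Φ(G))`, the center of the Frattini subgroup, as a subgroup of `G`. -/
abbrev frattiniCenter (G : Type*) [Group G] : Subgroup G :=
  (Subgroup.center (frattini G)).map (frattini G).subtype

instance frattiniCenter.instCommGroup (G : Type*) [Group G] : CommGroup (frattiniCenter G) :=
  { (inferInstance : Group (frattiniCenter G)) with
    mul_comm := (inferInstance : IsMulCommutative (frattiniCenter G)).is_comm.comm }

/-- The conjugation action of the Frattini quotient `G/Φ(G)` on `Z(Φ(G))`:
the class of `g` sends `a` to `g * a * g⁻¹`. -/
def frattiniConj (G : Type*) [Group G] : (G ⧸ frattini G) →* MulAut (frattiniCenter G) :=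
  QuotientGroup.lift (frattini G) MulAut.conjNormal <| by
    intro g hg
    ext ⟨a, ha⟩
    obtain ⟨z, hz, rfl⟩ := ha
    have h := congrArg Subtype.val (Subgroup.mem_center_iff.mp hz ⟨g, hg⟩)
    simp only [Subgroup.coe_mul] at h
    simp only [MulAut.conjNormal_apply, MulAut.one_apply, Subgroup.coe_subtype]
    rw [h, mul_inv_cancel_right]

/-- The `ℤ[G/Φ(G)]`-module `Z(Φ(G))`, written additively, with the conjugation action.
The coefficient ring is a copy of `ℤ` in the universe of `G`, because Mathlib's Tate cohomology
asks for the ring and the group to live in the same universe. -/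
def frattiniRepresentation.{u} (G : Type u) [Group G] :
    Representation (ULift.{u} ℤ) (G ⧸ frattini G) (Additive (frattiniCenter G)) where
  toFun q :=
    { toFun := fun a => Additive.ofMul (frattiniConj G q a.toMul)
      map_add' := by
        intro a b
        simp
      map_smul' := by
        intro n a
        simp [ULift.smul_def] }
  map_one' := by
    ext a
    simp
  map_mul' := by
    intro q r
    ext a
    simp

/-- The Tate cohomology group `Ĥ⁰(G/Φ(G); Z(Φ(G)))` of a finite group `G`. -/
noncomputable def frattiniTateZero.{u} (G : Type u) [Group G] [Finite G] :
    ModuleCat.{u} (ULift.{u} ℤ) :=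
  letI : Fintype (G ⧸ frattini G) := Fintype.ofFinite _
  tateCohomology (Rep.of (frattiniRepresentation G)) 0

/-- An NS-group: a finite nonabelian `p`-group `G`, for some prime `p`, such that
`Ĥ⁰(G/Φ(G); Z(Φ(G))) = 0`. -/
structure IsNSGroup (G : Type*) [Group G] [Finite G] : Prop where
  isPGroup : ∃ p : ℕ, p.Prime ∧ IsPGroup p G
  nonabelian : ∃ a b : G, a * b ≠ b * a
  tate_eq_zero : CategoryTheory.Limits.IsZero (frattiniTateZero G)

/-!
Write `A = Z(Φ(G))`, regarded as an additive group with the conjugation action of the elementary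
abelian `2`-group `Q = G / Φ(G)`. The vanishing of `Ĥ⁰(Q; A)` says that each invariant of `A` is
the norm of some element.

For an involution `t` of a finite abelian `2`-group, the Herbrand quotient is one, so vanishing of
`Ĥ⁰` entails vanishing of `Ĥ¹` (`FixedAreNorms.mem_augIn_of_norm_eq_zero`), and a nonzero acyclic
module over `⟨t⟩` has order at least four (`FixedAreNorms.four_le_card`). Let `s`, `t` be
commuting involutions of `M` such that `Ĥ⁰(⟨s, t⟩; M) = 0`. Then `Ĥ⁰(⟨s⟩; M) = 0`
(`IsFourGroupAcyclic.fixedAreNorms`), and both `Mˢ` and `(1 - s) M ≅ M / Mˢ` are acyclic over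
`⟨t⟩`. So if `M ≠ 0` both have order at least four and `|M| = |Mˢ| |(1 - s) M| ≥ 16`. If `|M| =
16`, both have order exactly four and are elementary abelian; hence `2 M` is fixed by `s`, and by
symmetry by the whole four-group, whose group of invariants has order two.

If `H` is a subgroup of index four in `Q`, this applies to the fixed points `A^H` under `Q / H`.
When `|Q| ≥ 8`, comparing a subgroup `H` that contains a given `x` with one that avoids it gives
`|A| ≥ 64` (`InvariantsAreNorms.sixtyFour_le_card`), while `|Φ(G)| ≤ 32`. When `|Q| ≤ 2`, the
group `G` is cyclic. Therefore `|Q| = 4` and `|Φ(G)| = 64`.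

The group `Φ(G)` is not abelian: otherwise `A = Φ(G)`, and vanishing of the cohomology of `⟨x⟩`
lets two generators of `Q` be lifted to commuting elements of `G` (`exists_commute_lifts`), which
generate `G`. So the center `A` has index at least four in `Φ(G)`, which leaves `|A| = 16`. The
action of `Q` on `A` is faithful, so `Z(G) ≤ Φ(G)` and `Z(G)` is the group of invariants, of order
two; it contains all squares of `A`. This gives the type of `A / Z(G)` and the two possible types
of `A`.
-/

/-! ### Involutions on abelian groups whose fixed points are norms -/

section Involution

variable {A : Type*} [AddCommGroup A]

/-- The elements of `B` fixed by the endomorphism `t`. -/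
def fixedIn (B : AddSubgroup A) (t : AddMonoid.End A) : AddSubgroup A :=
  B ⊓ AddMonoidHom.ker (1 - t)

/-- The image `(1 - t) B`. -/
def augIn (B : AddSubgroup A) (t : AddMonoid.End A) : AddSubgroup A :=
  B.map (1 - t)

/-- For an involution `t` preserving `B`, the vanishing of `Ĥ⁰(⟨t⟩; B)`: each fixed point in `B`
is a norm from `B`. -/
def FixedAreNorms (B : AddSubgroup A) (t : AddMonoid.End A) : Prop :=
  ∀ b ∈ B, t b = b → ∃ a ∈ B, a + t a = b

lemma mem_fixedIn {B : AddSubgroup A} {t : AddMonoid.End A} {a : A} :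
    a ∈ fixedIn B t ↔ a ∈ B ∧ t a = a := by
  rw [fixedIn, AddSubgroup.mem_inf, AddMonoidHom.mem_ker]
  change a ∈ B ∧ a - t a = 0 ↔ _
  rw [sub_eq_zero, eq_comm (a := a)]

lemma mem_augIn {B : AddSubgroup A} {t : AddMonoid.End A} {a : A} :
    a ∈ augIn B t ↔ ∃ b ∈ B, b - t b = a := by
  rfl

lemma involution_apply {t : AddMonoid.End A} (ht : t * t = 1) (a : A) : t (t a) = a :=
  DFunLike.congr_fun ht a

/-- A divisible subgroup of an abelian `2`-group of bounded exponent is trivial. -/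
lemma eq_zero_of_forall_two_nsmul {n : ℕ} (hA : ∀ a : A, 2 ^ n • a = 0) {B : AddSubgroup A}
    (h : ∀ b ∈ B, ∃ a ∈ B, 2 • a = b) {b : A} (hb : b ∈ B) : b = 0 := by
  have key : ∀ k : ℕ, ∀ b ∈ B, ∃ a ∈ B, 2 ^ k • a = b := by
    intro k
    induction k with
    | zero => exact fun b hb => ⟨b, hb, by simp⟩
    | succ k ih =>
      intro b hb
      obtain ⟨a, ha, rfl⟩ := ih b hb
      obtain ⟨c, hc, rfl⟩ := h a ha
      exact ⟨c, hc, by rw [pow_succ, mul_nsmul']⟩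
  obtain ⟨a, -, rfl⟩ := key n b hb
  exact hA a

/-- `|f(B)| · |ker f ∩ B| = |B|`. -/
lemma card_map_mul_card_inf_ker (B : AddSubgroup A) (f : A →+ A) :
    Nat.card (B.map f) * Nat.card (B ⊓ f.ker : AddSubgroup A) = Nat.card B := by
  have h1 := AddSubgroup.card_mul_index (f.comp B.subtype).ker
  rw [AddSubgroup.index_ker, AddMonoidHom.range_comp, AddSubgroup.range_subtype] at h1
  rw [← h1, mul_comm]
  congr 1
  refine Nat.card_congr ⟨fun a => ⟨⟨a, a.2.1⟩, a.2.2⟩, fun a => ⟨a.1.1, a.1.2, a.2⟩, ?_, ?_⟩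
  · intro a; rfl
  · intro a; rfl

lemma card_augIn_mul_card_fixedIn (B : AddSubgroup A) (t : AddMonoid.End A) :
    Nat.card (augIn B t) * Nat.card (fixedIn B t) = Nat.card B :=
  card_map_mul_card_inf_ker B (1 - t : AddMonoid.End A)

/-- The Herbrand quotient of a finite module over a group of order two is one: if all fixed points
are norms, then all elements of norm zero lie in `(1 - t) B`. -/
lemma FixedAreNorms.mem_augIn_of_norm_eq_zero [Finite A] {B : AddSubgroup A}
    {t : AddMonoid.End A} (ht : t * t = 1) (hB : ∀ b ∈ B, t b ∈ B) (h : FixedAreNorms B t)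
    {b : A} (hb : b ∈ B) (hb0 : b + t b = 0) : b ∈ augIn B t := by
  have h1 := card_augIn_mul_card_fixedIn B t
  have h3 : B.map (1 + t) = fixedIn B t := by
    apply le_antisymm
    · rintro _ ⟨a, ha, rfl⟩
      rw [mem_fixedIn]
      refine ⟨B.add_mem ha (hB a ha), ?_⟩
      change t (a + t a) = a + t a
      rw [map_add, involution_apply ht, add_comm]
    · intro a ha
      obtain ⟨c, hc, hca⟩ := h a (mem_fixedIn.1 ha).1 (mem_fixedIn.1 ha).2
      exact ⟨c, hc, hca⟩
  have h4 : augIn B t ≤ B ⊓ AddMonoidHom.ker (1 + t) := by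
    rintro _ ⟨a, ha, rfl⟩
    refine ⟨B.sub_mem ha (hB a ha), ?_⟩
    change (a - t a) + t (a - t a) = 0
    rw [map_sub, involution_apply ht]
    abel
  have h5 : augIn B t = B ⊓ AddMonoidHom.ker (1 + t) := by
    refine AddSubgroup.eq_of_le_of_card_ge h4 (le_of_eq ?_)
    have h2 : Nat.card (fixedIn B t) *
        Nat.card (B ⊓ AddMonoidHom.ker (1 + t) : AddSubgroup A) = Nat.card B := by
      rw [← h3]
      exact card_map_mul_card_inf_ker B (1 + t : AddMonoid.End A)
    rw [mul_comm] at h2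
    exact Nat.eq_of_mul_eq_mul_right Nat.card_pos (h2.trans h1.symm)
  rw [h5]
  exact ⟨hb, hb0⟩

lemma two_le_card_of_ne_zero [Finite A] {B : AddSubgroup A} {b : A} (hb : b ∈ B) (h0 : b ≠ 0) :
    2 ≤ Nat.card B := by
  have : Nontrivial B := ⟨⟨⟨b, hb⟩, 0, fun h => h0 (congrArg Subtype.val h)⟩⟩
  exact Finite.one_lt_card

/-- An involution of a nonzero `2`-group whose fixed points are norms acts nontrivially, as
otherwise the group would be divisible by two. -/
lemma FixedAreNorms.exists_ne [Finite A] {n : ℕ} (hA : ∀ a : A, 2 ^ n • a = 0)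
    {B : AddSubgroup A} {t : AddMonoid.End A} (h : FixedAreNorms B t) (h0 : B ≠ ⊥) :
    ∃ b ∈ B, t b ≠ b := by
  by_contra! hc
  refine h0 ((AddSubgroup.eq_bot_iff_forall _).2 fun b hb =>
    eq_zero_of_forall_two_nsmul hA (fun c hcB => ?_) hb)
  obtain ⟨a, ha, rfl⟩ := h c hcB (hc c hcB)
  exact ⟨a, ha, by rw [hc a ha, two_nsmul]⟩

lemma FixedAreNorms.two_le_card_augIn [Finite A] {n : ℕ} (hA : ∀ a : A, 2 ^ n • a = 0)
    {B : AddSubgroup A} {t : AddMonoid.End A} (h : FixedAreNorms B t) (h0 : B ≠ ⊥) :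
    2 ≤ Nat.card (augIn B t) := by
  obtain ⟨b, hb, hne⟩ := h.exists_ne hA h0
  exact two_le_card_of_ne_zero (mem_augIn.2 ⟨b, hb, rfl⟩) (sub_ne_zero.2 (Ne.symm hne))

lemma FixedAreNorms.two_le_card_fixedIn [Finite A] {n : ℕ} (hA : ∀ a : A, 2 ^ n • a = 0)
    {B : AddSubgroup A} {t : AddMonoid.End A} (ht : t * t = 1) (hB : ∀ b ∈ B, t b ∈ B)
    (h : FixedAreNorms B t) (h0 : B ≠ ⊥) : 2 ≤ Nat.card (fixedIn B t) := by
  by_contra! hlt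
  have hnorm : ∀ b ∈ B, b + t b = 0 := by
    intro b hb
    by_contra hne
    refine absurd (two_le_card_of_ne_zero (mem_fixedIn.2 ⟨B.add_mem hb (hB b hb), ?_⟩) hne)
      (not_le.2 hlt)
    rw [map_add, involution_apply ht, add_comm]
  -- With no nonzero fixed points `t` is `-1`, and then `(1 - t) B = 2 B` is all of `B`.
  refine h0 ((AddSubgroup.eq_bot_iff_forall _).2 fun b hb =>
    eq_zero_of_forall_two_nsmul hA (fun c hcB => ?_) hb)
  obtain ⟨a, ha, rfl⟩ := mem_augIn.1 (h.mem_augIn_of_norm_eq_zero ht hB hcB (hnorm c hcB))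
  refine ⟨a, ha, ?_⟩
  rw [two_nsmul, sub_eq_add_neg, neg_eq_of_add_eq_zero_left (hnorm a ha)]

lemma FixedAreNorms.four_le_card [Finite A] {n : ℕ} (hA : ∀ a : A, 2 ^ n • a = 0)
    {B : AddSubgroup A} {t : AddMonoid.End A} (ht : t * t = 1) (hB : ∀ b ∈ B, t b ∈ B)
    (h : FixedAreNorms B t) (h0 : B ≠ ⊥) : 4 ≤ Nat.card B := by
  rw [← card_augIn_mul_card_fixedIn B t]
  exact Nat.mul_le_mul (h.two_le_card_augIn hA h0) (h.two_le_card_fixedIn hA ht hB h0)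

/-- A module of order four over a group of order two all of whose fixed points are norms has
exactly two fixed points. -/
lemma FixedAreNorms.card_fixedIn_eq_two [Finite A] {n : ℕ} (hA : ∀ a : A, 2 ^ n • a = 0)
    {B : AddSubgroup A} {t : AddMonoid.End A} (ht : t * t = 1) (hB : ∀ b ∈ B, t b ∈ B)
    (h : FixedAreNorms B t) (h4 : Nat.card B = 4) : Nat.card (fixedIn B t) = 2 := by
  have h0 : B ≠ ⊥ := by
    rintro rfl
    simp at h4
  have h1 := card_augIn_mul_card_fixedIn B t
  have h2 := h.two_le_card_augIn hA h0
  have h3 := h.two_le_card_fixedIn hA ht hB h0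
  rw [h4] at h1
  nlinarith

/-- In a group of order two all nonzero elements agree. -/
lemma eq_of_card_eq_two {B : AddSubgroup A} (h2 : Nat.card B = 2) {a b : A}
    (ha : a ∈ B) (hb : b ∈ B) (ha0 : a ≠ 0) (hb0 : b ≠ 0) : a = b := by
  have hf : Finite B := Nat.finite_of_card_ne_zero (by omega)
  obtain ⟨u, hu⟩ := (Nat.card_eq_two_iff' (0 : B)).1 h2
  have h1 := hu.2 ⟨a, ha⟩ (fun h => ha0 (congrArg Subtype.val h))
  have h3 := hu.2 ⟨b, hb⟩ (fun h => hb0 (congrArg Subtype.val h))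
  exact congrArg Subtype.val (h1.trans h3.symm)

/-- A module of order four over a group of order two all of whose fixed points are norms is
elementary abelian. Here `2 b = (b - t b) + (b + t b)`, both summands lie in the subgroup of order
two of fixed points, and each vanishes exactly when `b` is fixed. -/
lemma FixedAreNorms.two_nsmul_eq_zero [Finite A] {n : ℕ} (hA : ∀ a : A, 2 ^ n • a = 0)
    {B : AddSubgroup A} {t : AddMonoid.End A} (ht : t * t = 1) (hB : ∀ b ∈ B, t b ∈ B)
    (h : FixedAreNorms B t) (h4 : Nat.card B = 4) {b : A} (hb : b ∈ B) : 2 • b = 0 := by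
  have hF := h.card_fixedIn_eq_two hA ht hB h4
  have hD : Nat.card (augIn B t) = 2 := by
    have h1 := card_augIn_mul_card_fixedIn B t
    rw [hF, h4] at h1
    omega
  have tors : ∀ {C : AddSubgroup A}, Nat.card C = 2 → ∀ c ∈ C, c + c = 0 := by
    intro C hC c hc
    have := card_nsmul_eq_zero' (x := (⟨c, hc⟩ : C))
    rw [hC, two_nsmul] at this
    exact congrArg Subtype.val this
  have hDF : augIn B t ≤ fixedIn B t := by
    intro d hd
    have hd2 := tors hD d hd
    obtain ⟨a, ha, rfl⟩ := mem_augIn.1 hd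
    refine mem_fixedIn.2 ⟨B.sub_mem ha (hB a ha), ?_⟩
    rw [map_sub, involution_apply ht, ← neg_sub a (t a)]
    exact neg_eq_of_add_eq_zero_left hd2
  have hN : b + t b ∈ fixedIn B t := by
    refine mem_fixedIn.2 ⟨B.add_mem hb (hB b hb), ?_⟩
    rw [map_add, involution_apply ht, add_comm]
  have hS : b - t b ∈ fixedIn B t := hDF (mem_augIn.2 ⟨b, hb, rfl⟩)
  have hsum : 2 • b = (b - t b) + (b + t b) := by
    rw [two_nsmul]
    abel
  rw [hsum]
  by_cases hfix : t b = b
  · have hbF := tors hF b (mem_fixedIn.2 ⟨hb, hfix⟩)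
    rw [hfix, sub_self, zero_add, hbF]
  · have hne : b + t b ≠ 0 := fun h0 =>
      hfix (mem_fixedIn.1 (hDF (h.mem_augIn_of_norm_eq_zero ht hB hb h0))).2
    rw [eq_of_card_eq_two hF hS hN (sub_ne_zero.2 (Ne.symm hfix)) hne]
    exact tors hF _ hN

end Involution

/-! ### Two commuting involutions -/

section TwoInvolutions

variable {A : Type*} [AddCommGroup A]

/-- A subgroup `M` of an abelian group with two commuting involutions `s`, `t` that preserve `M`,
such that each element of `M` fixed by both is a norm from `M` for the four-group `⟨s, t⟩`. -/
structure IsFourGroupAcyclic (M : AddSubgroup A) (s t : AddMonoid.End A) : Prop where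
  left_sq : s * s = 1
  right_sq : t * t = 1
  comm : ∀ a, s (t a) = t (s a)
  left_mem : ∀ m ∈ M, s m ∈ M
  right_mem : ∀ m ∈ M, t m ∈ M
  exists_norm : ∀ m ∈ M, s m = m → t m = m → ∃ a ∈ M, (a + s a) + t (a + s a) = m

namespace IsFourGroupAcyclic

variable {M : AddSubgroup A} {s t : AddMonoid.End A}

lemma right_mem_fixedIn (h : IsFourGroupAcyclic M s t) : ∀ m ∈ fixedIn M s, t m ∈ fixedIn M s := by
  intro m hm
  rw [mem_fixedIn] at hm ⊢
  exact ⟨h.right_mem m hm.1, by rw [h.comm, hm.2]⟩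

lemma right_mem_augIn (h : IsFourGroupAcyclic M s t) : ∀ m ∈ augIn M s, t m ∈ augIn M s := by
  intro m hm
  obtain ⟨a, ha, rfl⟩ := mem_augIn.1 hm
  exact mem_augIn.2 ⟨t a, h.right_mem a ha, by rw [h.comm, map_sub]⟩

lemma symm (h : IsFourGroupAcyclic M s t) : IsFourGroupAcyclic M t s where
  left_sq := h.right_sq
  right_sq := h.left_sq
  comm a := (h.comm a).symm
  left_mem := h.right_mem
  right_mem := h.left_mem
  exists_norm m hm h1 h2 := by
    obtain ⟨a, ha, rfl⟩ := h.exists_norm m hm h2 h1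
    refine ⟨a, ha, ?_⟩
    rw [map_add, map_add, h.comm]
    abel

lemma fixedAreNorms_fixedIn (h : IsFourGroupAcyclic M s t) : FixedAreNorms (fixedIn M s) t := by
  intro m hm htm
  rw [mem_fixedIn] at hm
  obtain ⟨a, ha, rfl⟩ := h.exists_norm m hm.1 hm.2 htm
  refine ⟨a + s a, mem_fixedIn.2 ⟨M.add_mem ha (h.left_mem a ha), ?_⟩, rfl⟩
  rw [map_add, involution_apply h.left_sq, add_comm]

/-- Vanishing of `Ĥ⁰` for the four-group passes to the subgroup `⟨s⟩`. Since `Ĥ¹(⟨t⟩; Mˢ)`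
vanishes along with `Ĥ⁰(⟨t⟩; Mˢ)`, the group `Mˢ` lies in `(1 + s) M + (1 - t) Mˢ`; as `(1 - t)² =
2 (1 - t)`, it lies in `(1 + s) M + 2 Mˢ`, so in `(1 + s) M`. -/
lemma fixedAreNorms [Finite A] {n : ℕ} (hA : ∀ a : A, 2 ^ n • a = 0)
    (h : IsFourGroupAcyclic M s t) : FixedAreNorms M s := by
  have step : ∀ m ∈ fixedIn M s, ∃ a ∈ M, ∃ c ∈ fixedIn M s, m = (a + s a) + (c - t c) := by
    intro m hm
    have hnm : m + t m ∈ fixedIn M s := AddSubgroup.add_mem _ hm (h.right_mem_fixedIn m hm)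
    obtain ⟨a, ha, hEq⟩ := h.exists_norm (m + t m) (mem_fixedIn.1 hnm).1 (mem_fixedIn.1 hnm).2
      (by rw [map_add, involution_apply h.right_sq, add_comm])
    have hb : a + s a ∈ fixedIn M s := by
      refine mem_fixedIn.2 ⟨M.add_mem ha (h.left_mem a ha), ?_⟩
      rw [map_add, involution_apply h.left_sq, add_comm]
    have h0 : (m - (a + s a)) + t (m - (a + s a)) = 0 := by
      rw [map_sub, sub_add_sub_comm, hEq, sub_self]
    obtain ⟨c, hc, hcEq⟩ := mem_augIn.1 (h.fixedAreNorms_fixedIn.mem_augIn_of_norm_eq_zero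
      h.right_sq h.right_mem_fixedIn (AddSubgroup.sub_mem _ hm hb) h0)
    exact ⟨a, ha, c, hc, by rw [hcEq]; abel⟩
  have step2 : ∀ m ∈ fixedIn M s, ∃ a ∈ M, ∃ c ∈ fixedIn M s, m = (a + s a) + 2 • c := by
    intro m hm
    obtain ⟨a, ha, c, hc, rfl⟩ := step m hm
    obtain ⟨a', ha', c', hc', rfl⟩ := step c hc
    refine ⟨a + (a' - t a'), M.add_mem ha (M.sub_mem ha' (h.right_mem a' ha')), c' - t c',
      AddSubgroup.sub_mem _ hc' (h.right_mem_fixedIn c' hc'), ?_⟩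
    simp only [map_add, map_sub, h.comm, involution_apply h.right_sq, two_nsmul]
    abel
  have iter : ∀ k : ℕ, ∀ m ∈ fixedIn M s, ∃ a ∈ M, ∃ c ∈ fixedIn M s,
      m = (a + s a) + 2 ^ k • c := by
    intro k
    induction k with
    | zero => exact fun m hm => ⟨0, M.zero_mem, m, hm, by simp⟩
    | succ k ih =>
      intro m hm
      obtain ⟨a, ha, c, hc, rfl⟩ := ih m hm
      obtain ⟨a', ha', c', hc', rfl⟩ := step2 c hc
      refine ⟨a + 2 ^ k • a', M.add_mem ha (M.nsmul_mem ha' _), c', hc', ?_⟩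
      rw [map_add, map_nsmul, nsmul_add, nsmul_add, pow_succ, mul_nsmul']
      abel
  intro m hm hsm
  obtain ⟨a, ha, c, -, hEq⟩ := iter n m (mem_fixedIn.2 ⟨hm, hsm⟩)
  exact ⟨a, ha, by rw [hEq, hA, add_zero]⟩

/-- The long exact cohomology sequence of `0 → Mˢ → M → (1 - s) M → 0` over `⟨t⟩`, whose first two
terms are acyclic. -/
lemma fixedAreNorms_augIn [Finite A] {n : ℕ} (hA : ∀ a : A, 2 ^ n • a = 0)
    (h : IsFourGroupAcyclic M s t) : FixedAreNorms (augIn M s) t := by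
  intro d hd htd
  obtain ⟨m, hm, rfl⟩ := mem_augIn.1 hd
  have hk : m - t m ∈ fixedIn M s := by
    refine mem_fixedIn.2 ⟨M.sub_mem hm (h.right_mem m hm), ?_⟩
    rw [map_sub, ← h.comm] at htd
    rw [map_sub, sub_eq_sub_iff_add_eq_add]
    rw [sub_eq_sub_iff_add_eq_add] at htd
    rw [add_comm, htd, add_comm]
  obtain ⟨k, hkM, hkEq⟩ := mem_augIn.1 (h.fixedAreNorms_fixedIn.mem_augIn_of_norm_eq_zero
    h.right_sq h.right_mem_fixedIn hk (by rw [map_sub, involution_apply h.right_sq]; abel))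
  rw [mem_fixedIn] at hkM
  obtain ⟨a, ha, haEq⟩ := h.symm.fixedAreNorms hA (m - k) (M.sub_mem hm hkM.1) (by
    rw [map_sub, sub_eq_sub_iff_add_eq_add]
    rw [sub_eq_sub_iff_add_eq_add] at hkEq
    rw [add_comm, ← hkEq, add_comm])
  refine ⟨a - s a, mem_augIn.2 ⟨a, ha, rfl⟩, ?_⟩
  have h1 : m = k + (a + t a) := by rw [haEq]; abel
  rw [h1, map_add, hkM.2, map_add, map_sub, h.comm]
  abel

lemma four_le_card_fixedIn [Finite A] {n : ℕ} (hA : ∀ a : A, 2 ^ n • a = 0)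
    (h : IsFourGroupAcyclic M s t) (h0 : M ≠ ⊥) : 4 ≤ Nat.card (fixedIn M s) := by
  refine h.fixedAreNorms_fixedIn.four_le_card hA h.right_sq h.right_mem_fixedIn fun hb => ?_
  have := (h.fixedAreNorms hA).two_le_card_fixedIn hA h.left_sq h.left_mem h0
  rw [hb] at this
  simp at this

lemma four_le_card_augIn [Finite A] {n : ℕ} (hA : ∀ a : A, 2 ^ n • a = 0)
    (h : IsFourGroupAcyclic M s t) (h0 : M ≠ ⊥) : 4 ≤ Nat.card (augIn M s) := by
  refine (h.fixedAreNorms_augIn hA).four_le_card hA h.right_sq h.right_mem_augIn fun hb => ?_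
  have := (h.fixedAreNorms hA).two_le_card_augIn hA h0
  rw [hb] at this
  simp at this

lemma sixteen_le_card [Finite A] {n : ℕ} (hA : ∀ a : A, 2 ^ n • a = 0)
    (h : IsFourGroupAcyclic M s t) (h0 : M ≠ ⊥) : 16 ≤ Nat.card M := by
  rw [← card_augIn_mul_card_fixedIn M s]
  exact Nat.mul_le_mul (h.four_le_card_augIn hA h0) (h.four_le_card_fixedIn hA h0)

lemma card_augIn_and_card_fixedIn_eq_four [Finite A] {n : ℕ} (hA : ∀ a : A, 2 ^ n • a = 0)
    (h : IsFourGroupAcyclic M s t) (h16 : Nat.card M = 16) :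
    Nat.card (augIn M s) = 4 ∧ Nat.card (fixedIn M s) = 4 := by
  have h0 : M ≠ ⊥ := by
    rintro rfl
    simp at h16
  have h1 := card_augIn_mul_card_fixedIn M s
  have h2 := h.four_le_card_augIn hA h0
  have h3 := h.four_le_card_fixedIn hA h0
  rw [h16] at h1
  constructor <;> nlinarith

lemma apply_two_nsmul [Finite A] {n : ℕ} (hA : ∀ a : A, 2 ^ n • a = 0)
    (h : IsFourGroupAcyclic M s t) (h16 : Nat.card M = 16) {m : A} (hm : m ∈ M) :
    s (2 • m) = 2 • m := by
  have := (h.fixedAreNorms_augIn hA).two_nsmul_eq_zero hA h.right_sq h.right_mem_augIn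
    (h.card_augIn_and_card_fixedIn_eq_four hA h16).1 (mem_augIn.2 ⟨m, hm, rfl⟩)
  rw [nsmul_sub, sub_eq_zero] at this
  rw [map_nsmul, ← this]

lemma card_fixedIn_fixedIn [Finite A] {n : ℕ} (hA : ∀ a : A, 2 ^ n • a = 0)
    (h : IsFourGroupAcyclic M s t) (h16 : Nat.card M = 16) :
    Nat.card (fixedIn (fixedIn M s) t) = 2 :=
  h.fixedAreNorms_fixedIn.card_fixedIn_eq_two hA h.right_sq h.right_mem_fixedIn
    (h.card_augIn_and_card_fixedIn_eq_four hA h16).2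

end IsFourGroupAcyclic

end TwoInvolutions

/-! ### Elementary abelian two-groups acting on abelian groups -/

section Representation

variable {A : Type*} [AddCommGroup A] {Q : Type*} [Group Q]

/-- The elements of `A` fixed by the subgroup `H` of `Q`. -/
def fixedBy (ρ : Q →* AddMonoid.End A) (H : Subgroup Q) : AddSubgroup A where
  carrier := {a | ∀ h ∈ H, ρ h a = a}
  zero_mem' h _ := map_zero _
  add_mem' ha hb h hh := by rw [map_add, ha h hh, hb h hh]
  neg_mem' ha h hh := by rw [map_neg, ha h hh]

lemma mem_fixedBy {ρ : Q →* AddMonoid.End A} {H : Subgroup Q} {a : A} :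
    a ∈ fixedBy ρ H ↔ ∀ h ∈ H, ρ h a = a :=
  Iff.rfl

/-- The vanishing of `Ĥ⁰(Q; A)`: each invariant is the norm of some element. -/
def InvariantsAreNorms [Fintype Q] (ρ : Q →* AddMonoid.End A) : Prop :=
  ∀ a, (∀ q, ρ q a = a) → ∃ b, ∑ q, ρ q b = a

lemma map_mul_apply (ρ : Q →* AddMonoid.End A) (x y : Q) (a : A) :
    ρ (x * y) a = ρ x (ρ y a) := by
  rw [map_mul]; rfl

lemma mul_comm_of_forall_mul_self_eq_one (hQ : ∀ q : Q, q * q = 1) (a b : Q) :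
    a * b = b * a := by
  have h1 : a⁻¹ = a := inv_eq_of_mul_eq_one_left (hQ a)
  have h2 : b⁻¹ = b := inv_eq_of_mul_eq_one_left (hQ b)
  have h3 : (a * b)⁻¹ = a * b := inv_eq_of_mul_eq_one_left (hQ _)
  rw [← h3, mul_inv_rev, h1, h2]

/-- A subgroup `H` of index four in an elementary abelian `2`-group and elements `x`, `y` that
generate the quotient parametrize the group as `H × ⟨x⟩ × ⟨y⟩`. -/
lemma bijective_mul_of_card_eq_four_mul [Finite Q] (hQ : ∀ q : Q, q * q = 1) {H : Subgroup Q}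
    (hH : Nat.card Q = 4 * Nat.card H) {x y : Q} (hx : x ∉ H) (hy : y ∉ H) (hxy : y * x ∉ H) :
    Function.Bijective
      (fun p : (Bool × Bool) × H => (cond p.1.1 y 1 * cond p.1.2 x 1) * (p.2 : Q)) := by
  have comm := mul_comm_of_forall_mul_self_eq_one hQ
  have hsq : ∀ a b : Q, a * (a * b) = b := fun a b => by rw [← mul_assoc, hQ, one_mul]
  rw [Nat.bijective_iff_injective_and_card]
  constructor
  · have key : ∀ i j i' j' : Bool, ∀ h h' : H,
        (cond i y 1 * cond j x 1) * (h : Q) = (cond i' y 1 * cond j' x 1) * (h' : Q) →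
        i = i' ∧ j = j' := by
      intro i j i' j' h h' heq
      have h1 : (cond i' y 1 * cond j' x 1)⁻¹ * (cond i y 1 * cond j x 1) ∈ H := by
        have : (cond i' y 1 * cond j' x 1)⁻¹ * (cond i y 1 * cond j x 1) = h' * (h : Q)⁻¹ := by
          rw [eq_mul_inv_iff_mul_eq, mul_assoc, heq, inv_mul_cancel_left]
        rw [this]
        exact H.mul_mem h'.2 (H.inv_mem h.2)
      have inv : ∀ a : Q, a⁻¹ = a := fun a => inv_eq_of_mul_eq_one_left (hQ a)
      rw [inv] at h1
      have hxyx : y * x * y = x := by rw [comm y x, mul_assoc, hQ, mul_one]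
      have hyxx : y * x * x = y := by rw [mul_assoc, hQ, mul_one]
      have hxyxx : x * (y * x) = y := by rw [comm y x, hsq]
      have hxyc : x * y = y * x := comm x y
      cases i <;> cases j <;> cases i' <;> cases j' <;>
        simp only [cond_true, cond_false, mul_one, one_mul, hQ, hsq, hxyx, hyxx, hxyxx, hxyc]
          at h1 <;> first | exact ⟨rfl, rfl⟩ | exact absurd h1 ‹_›
    rintro ⟨⟨i, j⟩, h⟩ ⟨⟨i', j'⟩, h'⟩ heq
    obtain ⟨rfl, rfl⟩ := key i j i' j' h h' heq
    rw [Subtype.ext (mul_left_cancel heq : (h : Q) = h')]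
  · rw [Nat.card_prod, Nat.card_prod, hH]
    simp

/-- If `H` has index four in the elementary abelian `2`-group `Q` and `Ĥ⁰(Q; A)` vanishes, then
`Ĥ⁰(Q / H; A^H)` vanishes as well, because the norm for `Q` factors through the norm for `H`. -/
lemma InvariantsAreNorms.isFourGroupAcyclic [Fintype Q] (hQ : ∀ q : Q, q * q = 1)
    {ρ : Q →* AddMonoid.End A} (hρ : InvariantsAreNorms ρ) {H : Subgroup Q}
    (hH : Nat.card Q = 4 * Nat.card H) {x y : Q} (hx : x ∉ H) (hy : y ∉ H) (hxy : y * x ∉ H) :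
    IsFourGroupAcyclic (fixedBy ρ H) (ρ x) (ρ y) := by
  classical
  have comm := mul_comm_of_forall_mul_self_eq_one hQ
  have hmem : ∀ q : Q, ∀ m ∈ fixedBy ρ H, ρ q m ∈ fixedBy ρ H := by
    intro q m hm h hh
    rw [← map_mul_apply, comm, map_mul_apply, hm h hh]
  have hbij := bijective_mul_of_card_eq_four_mul hQ hH hx hy hxy
  refine ⟨by rw [← map_mul, hQ, map_one], by rw [← map_mul, hQ, map_one], fun a => ?_,
    hmem x, hmem y, fun m hm hxm hym => ?_⟩
  · rw [← map_mul_apply, comm, map_mul_apply]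
  · have hfix : ∀ q, ρ q m = m := by
      intro q
      obtain ⟨⟨⟨i, j⟩, h⟩, rfl⟩ := hbij.2 q
      simp only [map_mul_apply]
      rw [hm h h.2]
      cases i <;> cases j <;> simp [hxm, hym]
    obtain ⟨b, hb⟩ := hρ m hfix
    refine ⟨∑ h : H, ρ h b, ?_, ?_⟩
    · intro h hh
      rw [map_sum]
      refine Fintype.sum_equiv (Equiv.mulLeft (⟨h, hh⟩ : H)) _ _ fun k => ?_
      rw [← map_mul_apply]
      rfl
    · rw [← hb, ← hbij.sum_comp (fun q => ρ q b), Fintype.sum_prod_type, Fintype.sum_prod_type,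
        Fintype.sum_bool, Fintype.sum_bool, Fintype.sum_bool]
      simp only [map_mul_apply, cond_true, cond_false, map_one, AddMonoid.End.coe_one, id,
        map_sum, map_add]
      abel

/-- A `2`-group acting on a nontrivial abelian `2`-group has nonzero fixed points. -/
lemma fixedBy_ne_bot [Finite A] {n : ℕ} (hQ : IsPGroup 2 Q) (hA : Nat.card A = 2 ^ n) (hn : n ≠ 0)
    (ρ : Q →* AddMonoid.End A) (H : Subgroup Q) : fixedBy ρ H ≠ ⊥ := by
  let _ : MulAction H A :=
    { smul := fun h a => ρ h a
      one_smul := fun a => by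
        change ρ ((1 : H) : Q) a = a
        simp
      mul_smul := fun h k a => map_mul_apply ρ h k a }
  have h0 : (0 : A) ∈ MulAction.fixedPoints H A := fun h => map_zero (ρ h)
  obtain ⟨a, ha, hne⟩ := (hQ.to_subgroup H).exists_fixed_point_of_prime_dvd_card_of_fixed_point A
    (hA ▸ dvd_pow_self 2 hn) h0
  intro hbot
  have : a ∈ fixedBy ρ H := fun h hh => ha ⟨h, hh⟩
  rw [hbot, AddSubgroup.mem_bot] at this
  exact hne this.symm

lemma exists_notMem_and_mul_notMem [Finite Q] {H : Subgroup Q} (hH : Nat.card Q = 4 * Nat.card H)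
    {x : Q} : ∃ y, y ∉ H ∧ y * x ∉ H := by
  by_contra! hc
  have hpos : 0 < Nat.card H := Nat.card_pos
  -- Otherwise `Q` would be the union of the two cosets `H` and `H x⁻¹`, of total size `2 |H|`.
  have h1 : (Set.univ : Set Q) ⊆ (H : Set Q) ∪ (fun h => h * x⁻¹) '' (H : Set Q) := by
    intro y _
    by_cases hy : y ∈ H
    · exact Or.inl hy
    · exact Or.inr ⟨y * x, hc y hy, by simp⟩
  have h2 := (Set.ncard_le_ncard h1).trans (Set.ncard_union_le _ _)
  have h3 := Set.ncard_image_le (f := fun h => h * x⁻¹) (Set.toFinite (H : Set Q))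
  have h4 : (H : Set Q).ncard = Nat.card H := rfl
  rw [Set.ncard_univ] at h2
  omega

lemma exists_notMem_of_card_eq_four_mul [Finite Q] {H : Subgroup Q}
    (hH : Nat.card Q = 4 * Nat.card H) : ∃ x, x ∉ H := by
  obtain ⟨y, hy, -⟩ := exists_notMem_and_mul_notMem hH (x := 1)
  exact ⟨y, hy⟩

/-- If `Ĥ⁰(Q; A)` vanishes for an elementary abelian `2`-group `Q` of rank at least three acting on
a nontrivial abelian `2`-group `A`, then `|A| ≥ 64`. For `x ≠ 1`, the fixed points of a subgroup of
index four that contains `x` give `|Aˣ| ≥ 16`, and those of a subgroup of index four that avoids `x`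
give `|(1 - x) A| ≥ 4`. -/
lemma InvariantsAreNorms.sixtyFour_le_card [Fintype Q] [Finite A] {d n : ℕ}
    (hQ : ∀ q : Q, q * q = 1) (hd : Nat.card Q = 2 ^ (d + 3)) (hA : Nat.card A = 2 ^ n) (hn : n ≠ 0)
    {ρ : Q →* AddMonoid.End A} (hρ : InvariantsAreNorms ρ) : 64 ≤ Nat.card A := by
  have hA' : ∀ a : A, 2 ^ n • a = 0 := fun a => by rw [← hA]; exact card_nsmul_eq_zero'
  have hQp : IsPGroup 2 Q := IsPGroup.of_card hd
  have h4 : ∀ {H : Subgroup Q}, Nat.card H = 2 ^ (d + 1) → Nat.card Q = 4 * Nat.card H := by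
    intro H hH
    rw [hd, hH, pow_add, pow_add]
    ring
  obtain ⟨H, hH⟩ := Sylow.exists_subgroup_card_pow_prime 2 (G := Q) (n := d + 1)
    (hd ▸ pow_dvd_pow 2 (by omega))
  obtain ⟨x, hx⟩ := exists_notMem_of_card_eq_four_mul (h4 hH)
  obtain ⟨y, hy, hyx⟩ := exists_notMem_and_mul_notMem (h4 hH) (x := x)
  have hx1 : x ≠ 1 := fun h => hx (h ▸ H.one_mem)
  have hox : Nat.card (Subgroup.zpowers x) = 2 ^ 1 := by
    rw [Nat.card_zpowers, pow_one]
    exact orderOf_eq_prime (by rw [pow_two, hQ]) hx1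
  obtain ⟨K, hK, hxK⟩ := Sylow.exists_subgroup_card_pow_prime_le 2 (n := 1) (m := d + 1)
    (hd ▸ pow_dvd_pow 2 (by omega)) (Subgroup.zpowers x) hox (by omega)
  obtain ⟨u, hu⟩ := exists_notMem_of_card_eq_four_mul (h4 hK)
  obtain ⟨v, hv, hvu⟩ := exists_notMem_and_mul_notMem (h4 hK) (x := u)
  have h1 := (hρ.isFourGroupAcyclic hQ (h4 hH) hx hy hyx).four_le_card_augIn hA'
    (fixedBy_ne_bot hQp hA hn ρ H)
  have h2 := (hρ.isFourGroupAcyclic hQ (h4 hK) hu hv hvu).sixteen_le_card hA'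
    (fixedBy_ne_bot hQp hA hn ρ K)
  have h3 : augIn (fixedBy ρ H) (ρ x) ≤ augIn ⊤ (ρ x) := AddSubgroup.map_mono le_top
  have h5 : fixedBy ρ K ≤ fixedIn ⊤ (ρ x) := fun a ha =>
    mem_fixedIn.2 ⟨trivial, ha x (hxK (Subgroup.mem_zpowers x))⟩
  have h6 := card_augIn_mul_card_fixedIn ⊤ (ρ x)
  rw [AddSubgroup.card_top] at h6
  rw [← h6]
  exact Nat.mul_le_mul (h1.trans (AddSubgroup.card_le_of_le h3))
    (h2.trans (AddSubgroup.card_le_of_le h5))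

/-- For a four-group `Q`, any nontrivial element is part of a pair of generators. -/
lemma InvariantsAreNorms.exists_isFourGroupAcyclic_top [Fintype Q] (hQ : ∀ q : Q, q * q = 1)
    (h4 : Nat.card Q = 4) {ρ : Q →* AddMonoid.End A} (hρ : InvariantsAreNorms ρ) {x : Q}
    (hx : x ≠ 1) : ∃ y, y ≠ 1 ∧ y * x ≠ 1 ∧ IsFourGroupAcyclic (⊤ : AddSubgroup A) (ρ x) (ρ y) := by
  have hH : Nat.card Q = 4 * Nat.card (⊥ : Subgroup Q) := by
    rw [Subgroup.card_bot, h4]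
  obtain ⟨y, hy, hyx⟩ := exists_notMem_and_mul_notMem hH (x := x)
  have htop : fixedBy ρ ⊥ = ⊤ := by
    refine (AddSubgroup.eq_top_iff' _).2 fun a h hh => ?_
    rw [Subgroup.mem_bot.1 hh, map_one]
    rfl
  rw [← htop]
  exact ⟨y, hy, hyx, hρ.isFourGroupAcyclic hQ hH hx hy hyx⟩

lemma InvariantsAreNorms.exists_apply_ne [Fintype Q] [Finite A] {n : ℕ} (hQ : ∀ q : Q, q * q = 1)
    (h4 : Nat.card Q = 4) (hA : Nat.card A = 2 ^ n) (hn : n ≠ 0)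
    {ρ : Q →* AddMonoid.End A} (hρ : InvariantsAreNorms ρ) {x : Q} (hx : x ≠ 1) :
    ∃ a, ρ x a ≠ a := by
  have hA' : ∀ a : A, 2 ^ n • a = 0 := fun a => by rw [← hA]; exact card_nsmul_eq_zero'
  obtain ⟨y, -, -, h⟩ := hρ.exists_isFourGroupAcyclic_top hQ h4 hx
  obtain ⟨a, -, ha⟩ := (h.fixedAreNorms hA').exists_ne hA' fun hbot => by
    have := AddSubgroup.card_top (G := A)
    rw [hbot, AddSubgroup.card_bot, hA] at this
    exact (Nat.one_lt_two_pow hn).ne this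
  exact ⟨a, ha⟩

lemma InvariantsAreNorms.sixteen_le_card [Fintype Q] [Finite A] {n : ℕ} (hQ : ∀ q : Q, q * q = 1)
    (h4 : Nat.card Q = 4) (hA : Nat.card A = 2 ^ n) (hn : n ≠ 0)
    {ρ : Q →* AddMonoid.End A} (hρ : InvariantsAreNorms ρ) : 16 ≤ Nat.card A := by
  have hA' : ∀ a : A, 2 ^ n • a = 0 := fun a => by rw [← hA]; exact card_nsmul_eq_zero'
  have : Nontrivial Q := Finite.one_lt_card_iff_nontrivial.1 (by omega)
  obtain ⟨x, hx⟩ := exists_ne (1 : Q)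
  obtain ⟨y, -, -, h⟩ := hρ.exists_isFourGroupAcyclic_top hQ h4 hx
  rw [← AddSubgroup.card_top (G := A)]
  refine h.sixteen_le_card hA' fun hbot => ?_
  have := AddSubgroup.card_top (G := A)
  rw [hbot, AddSubgroup.card_bot, hA] at this
  exact (Nat.one_lt_two_pow hn).ne this

lemma InvariantsAreNorms.two_nsmul_mem_fixedBy_top [Fintype Q] [Finite A]
    (hQ : ∀ q : Q, q * q = 1) (h4 : Nat.card Q = 4) (hA : Nat.card A = 16)
    {ρ : Q →* AddMonoid.End A} (hρ : InvariantsAreNorms ρ) (a : A) :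
    2 • a ∈ fixedBy ρ ⊤ := by
  intro q _
  by_cases hq : q = 1
  · rw [hq, map_one]
    rfl
  have hA' : ∀ a : A, 2 ^ 4 • a = 0 := fun a => by
    have := card_nsmul_eq_zero' (x := a)
    rwa [hA] at this
  obtain ⟨y, -, -, h⟩ := hρ.exists_isFourGroupAcyclic_top hQ h4 hq
  exact h.apply_two_nsmul hA' (by rw [AddSubgroup.card_top, hA]) trivial

lemma InvariantsAreNorms.card_fixedBy_top [Fintype Q] [Finite A]
    (hQ : ∀ q : Q, q * q = 1) (h4 : Nat.card Q = 4) (hA : Nat.card A = 16)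
    {ρ : Q →* AddMonoid.End A} (hρ : InvariantsAreNorms ρ) :
    Nat.card (fixedBy ρ ⊤) = 2 := by
  have hA' : ∀ a : A, 2 ^ 4 • a = 0 := fun a => by
    have := card_nsmul_eq_zero' (x := a)
    rwa [hA] at this
  have : Nontrivial Q := Finite.one_lt_card_iff_nontrivial.1 (by omega)
  obtain ⟨x, hx⟩ := exists_ne (1 : Q)
  obtain ⟨y, hy, hyx, h⟩ := hρ.exists_isFourGroupAcyclic_top hQ h4 hx
  rw [← h.card_fixedIn_fixedIn hA' (by rw [AddSubgroup.card_top, hA])]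
  congr 2
  ext a
  simp only [mem_fixedIn, mem_fixedBy, AddSubgroup.mem_top, Subgroup.mem_top, true_and,
    forall_const]
  refine ⟨fun ha => ⟨ha x, ha y⟩, fun ha q => ?_⟩
  have hbij := bijective_mul_of_card_eq_four_mul hQ
    (show Nat.card Q = 4 * Nat.card (⊥ : Subgroup Q) by rw [Subgroup.card_bot, h4]) hx hy hyx
  obtain ⟨⟨⟨i, j⟩, ⟨k, hk⟩⟩, rfl⟩ := hbij.2 q
  obtain rfl := Subgroup.mem_bot.1 hk
  simp only [map_mul_apply]
  cases i <;> cases j <;> simp [ha.1, ha.2]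

end Representation

/-! ### Abelian groups of order sixteen -/

/-- A finite group of exponent two and order `2 ^ n` is `(ℤ/2)ⁿ`. -/
lemma nonempty_addEquiv_pi_zmod_two {A : Type*} [AddCommGroup A] {n : ℕ}
    (h : ∀ a : A, 2 • a = 0) (hc : Nat.card A = 2 ^ n) : Nonempty (A ≃+ (Fin n → ZMod 2)) := by
  let _ : Module (ZMod 2) A := AddCommGroup.zmodModule h
  have : Finite A := Nat.finite_of_card_ne_zero (by rw [hc]; positivity)
  have hr : Module.finrank (ZMod 2) A = n := by
    have := Module.natCard_eq_pow_finrank (K := ZMod 2) (V := A)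
    rw [hc, Nat.card_zmod] at this
    exact (Nat.pow_right_injective le_rfl this).symm
  exact ⟨(LinearEquiv.ofFinrankEq A (Fin n → ZMod 2)
    (hr.trans (Module.finrank_fin_fun _).symm)).toAddEquiv⟩

lemma nonempty_mulEquiv_pi_zmod_two {B : Type*} [Group B] {n : ℕ}
    (h : ∀ b : B, b * b = 1) (hc : Nat.card B = 2 ^ n) :
    Nonempty (B ≃* Multiplicative (Fin n → ZMod 2)) := by
  let _ : CommGroup B :=
    { (inferInstance : Group B) with mul_comm := mul_comm_of_forall_mul_self_eq_one h }
  obtain ⟨e⟩ := nonempty_addEquiv_pi_zmod_two (A := Additive B) (n := n)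
    (fun b => by rw [two_nsmul]; exact h b) hc
  exact ⟨AddEquiv.toMultiplicativeRight e⟩

/-- An abelian group of order sixteen whose squares lie in a subgroup of order two has type `(4,
2, 2)` or `(2, 2, 2, 2)`. If `2 a ≠ 0`, a complement of `2 a` in the `2`-torsion is a complement
of `a` in the group. -/
lemma nonempty_addEquiv_of_two_nsmul_mem {A : Type*} [AddCommGroup A] (hA : Nat.card A = 16)
    {Z : AddSubgroup A} (hZ : Nat.card Z = 2) (h : ∀ a : A, 2 • a ∈ Z) :
    Nonempty (A ≃+ ZMod 4 × (Fin 2 → ZMod 2)) ∨ Nonempty (A ≃+ (Fin 4 → ZMod 2)) := by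
  have hfin : Finite A := Nat.finite_of_card_ne_zero (by omega)
  by_cases hexp : ∀ a : A, 2 • a = 0
  · exact Or.inr (nonempty_addEquiv_pi_zmod_two hexp hA)
  left
  push Not at hexp
  obtain ⟨a, ha⟩ := hexp
  have hdvd : ∀ z ∈ Z, 2 • z = 0 := fun z hz => by
    have := card_nsmul_eq_zero' (x := (⟨z, hz⟩ : Z))
    rw [hZ] at this
    exact congrArg Subtype.val this
  let T : AddSubgroup A := (nsmulAddMonoidHom 2 : A →+ A).ker
  have hT : ∀ {b : A}, b ∈ T ↔ 2 • b = 0 := Iff.rfl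
  have hcT : Nat.card T = 8 := by
    have h1 := card_map_mul_card_inf_ker ⊤ (nsmulAddMonoidHom 2 : A →+ A)
    have h2 : AddSubgroup.map (nsmulAddMonoidHom 2 : A →+ A) ⊤ = Z := by
      refine AddSubgroup.eq_of_le_of_card_ge ?_ ?_
      · rintro _ ⟨b, -, rfl⟩
        exact h b
      · rw [hZ]
        exact two_le_card_of_ne_zero ⟨a, trivial, rfl⟩ ha
    rw [h2, top_inf_eq, AddSubgroup.card_top, hA, hZ] at h1
    change 2 * Nat.card T = 16 at h1
    omega
  have hT2 : ∀ b : T, 2 • b = 0 := fun b => Subtype.ext (hT.1 b.2)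
  let _ : Module (ZMod 2) T := AddCommGroup.zmodModule hT2
  let z : T := ⟨2 • a, hT.2 (hdvd _ (h a))⟩
  have hz : z ≠ 0 := fun h0 => ha (congrArg Subtype.val h0)
  obtain ⟨W, hW⟩ := Submodule.exists_isCompl (Submodule.span (ZMod 2) {z})
  have hfr : Module.finrank (ZMod 2) T = 3 := by
    have := Module.natCard_eq_pow_finrank (K := ZMod 2) (V := T)
    rw [hcT, Nat.card_zmod, show 8 = 2 ^ 3 by norm_num] at this
    exact (Nat.pow_right_injective le_rfl this).symm
  have hfW : Module.finrank (ZMod 2) W = 2 := by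
    have := Submodule.finrank_add_eq_of_isCompl hW
    rw [finrank_span_singleton hz, hfr] at this
    omega
  have e : (Fin 2 → ZMod 2) ≃+ W :=
    (LinearEquiv.ofFinrankEq (Fin 2 → ZMod 2) W
      ((Module.finrank_fin_fun _).trans hfW.symm)).toAddEquiv
  have h4a : 4 • a = 0 := by
    have := hdvd _ (h a)
    rwa [← mul_nsmul'] at this
  let f : ZMod 4 →+ A := ZMod.lift 4 ⟨zmultiplesHom A a, (natCast_zsmul a 4).trans h4a⟩
  let g : (Fin 2 → ZMod 2) →+ A :=
    T.subtype.comp (W.subtype.toAddMonoidHom.comp e.toAddMonoidHom)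
  have hgT : ∀ v, ∃ w : W, g v = ((w : T) : A) ∧ e v = w := fun v => ⟨e v, rfl, rfl⟩
  have hf : ∀ k : ℕ, f k = k • a := fun k => by
    have := ZMod.lift_coe 4 ⟨zmultiplesHom A a, (natCast_zsmul a 4).trans h4a⟩ (k : ℤ)
    simpa [f] using this
  let φ : ZMod 4 × (Fin 2 → ZMod 2) →+ A := f.coprod g
  have hinj : Function.Injective φ := by
    rw [injective_iff_map_eq_zero]
    rintro ⟨k, v⟩ hkv
    obtain ⟨w, hgw, hew⟩ := hgT v
    have hkv' : f k + w = 0 := by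
      rw [← hgw]
      exact hkv
    have hk4 := ZMod.natCast_zmod_val k
    have hlt := ZMod.val_lt k
    rw [← hk4, hf] at hkv'
    have hw2 : 2 • ((w : T) : A) = 0 := hT.1 (w : T).2
    -- Doubling the relation removes `w`, so `k` is even; then `k • a` is `0` or `2 • a`.
    have hk2 : (2 * k.val) • a = 0 := by
      have := congrArg (fun b => 2 • b) hkv'
      simpa [nsmul_add, hw2, mul_nsmul'] using this
    have hkval : k.val = 0 := by
      interval_cases hk : k.val
      · rfl
      · exact absurd hk2 ha
      · exfalso
        have hwz : (w : T) = z := by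
          apply Subtype.ext
          have h1 : ((w : T) : A) = -(2 • a) := eq_neg_of_add_eq_zero_right hkv'
          rw [h1]
          change -(2 • a) = 2 • a
          rw [neg_eq_iff_add_eq_zero, ← two_nsmul]
          exact hdvd _ (h a)
        have hdis := (Submodule.disjoint_def.1 hW.disjoint) z (Submodule.mem_span_singleton_self z)
          (hwz ▸ w.2)
        exact hz hdis
      · exfalso
        apply ha
        have h6 : (2 * 3) • a = 2 • a + 4 • a := by rw [← add_nsmul]
        rw [h6, h4a, add_zero] at hk2
        exact hk2
    have hk0 : k = 0 := (ZMod.val_eq_zero k).1 hkval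
    rw [hkval, zero_nsmul, zero_add] at hkv'
    have hw0 : w = 0 := Subtype.ext (Subtype.ext hkv')
    rw [hw0, EmbeddingLike.map_eq_zero_iff] at hew
    rw [hk0, hew]
    rfl
  have hbij : Function.Bijective φ := by
    rw [Nat.bijective_iff_injective_and_card]
    exact ⟨hinj, by simp [hA]⟩
  exact ⟨(AddEquiv.ofBijective φ hbij).symm⟩

/-! ### Tate cohomology in degree zero -/

section Tate

open CategoryTheory groupCohomology groupHomology

/-- If the degree zero Tate cohomology of a representation vanishes, then every invariant vector is
a norm. -/
lemma exists_norm_eq_of_isZero_tateCohomology.{u} {R G : Type u} [CommRing R] [Group G] [Fintype G]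
    (M : Rep.{u} R G) (h : Limits.IsZero (tateCohomology M 0)) {v : M} (hv : ∀ g, M.ρ g v = v) :
    ∃ w : M, M.ρ.norm w = v := by
  have hex : (tateComplex M).ExactAt 0 := HomologicalComplex.exactAt_iff_isZero_homology _ _ |>.2 h
  rw [HomologicalComplex.exactAt_iff' _ (-1) 0 1 (by simp) (by simp),
    ShortComplex.moduleCat_exact_iff] at hex
  have hd : (inhomogeneousCochains M).d 0 1 ((cochainsIso₀ M).inv v) = 0 := by
    have h1 := ConcreteCategory.congr_hom (eq_d₀₁_comp_inv M) v
    have h2 : d₀₁ M v = 0 := by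
      funext g
      exact sub_eq_zero.2 (hv g)
    rw [ConcreteCategory.comp_apply, ConcreteCategory.comp_apply, h2, map_zero] at h1
    exact h1
  obtain ⟨w, hw⟩ := hex ((cochainsIso₀ M).inv v) hd
  refine ⟨(chainsIso₀ M).hom w, ?_⟩
  have h3 : (cochainsIso₀ M).inv (M.ρ.norm ((chainsIso₀ M).hom w)) = (cochainsIso₀ M).inv v := hw
  exact (ConcreteCategory.injective_of_mono_of_preservesPullback (cochainsIso₀ M).inv) h3

end Tate

/-! ### The Frattini quotient -/

lemma mem_frattiniCenter {G : Type*} [Group G] {a : G} :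
    a ∈ frattiniCenter G ↔ a ∈ frattini G ∧ ∀ b ∈ frattini G, b * a = a * b := by
  constructor
  · rintro ⟨⟨z, hz⟩, hzc, rfl⟩
    exact ⟨hz, fun b hb => congrArg Subtype.val (Subgroup.mem_center_iff.1 hzc ⟨b, hb⟩)⟩
  · rintro ⟨ha, hc⟩
    exact ⟨⟨a, ha⟩, Subgroup.mem_center_iff.2 fun b => Subtype.ext (hc b b.2), rfl⟩

lemma card_frattiniCenter (G : Type*) [Group G] :
    Nat.card (frattiniCenter G) = Nat.card (Subgroup.center (frattini G)) :=
  Nat.card_congr ((Subgroup.center (frattini G)).equivMapOfInjective _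
    (Subgroup.subtype_injective _)).toEquiv.symm

/-- The action of the Frattini quotient on the additive group `Z(Φ(G))`. -/
def frattiniAction (G : Type*) [Group G] :
    (G ⧸ frattini G) →* AddMonoid.End (Additive (frattiniCenter G)) where
  toFun q := (frattiniRepresentation G q).toAddMonoidHom
  map_one' := by rw [map_one]; rfl
  map_mul' q r := by rw [map_mul]; rfl

lemma frattiniAction_mk {G : Type*} [Group G] (g : G) (a : Additive (frattiniCenter G)) :
    ((frattiniAction G (g : G ⧸ frattini G) a).toMul : G) = g * a.toMul * g⁻¹ :=
  rfl

lemma frattiniAction_mk_eq_iff {G : Type*} [Group G] {g : G} {a : Additive (frattiniCenter G)} :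
    frattiniAction G (g : G ⧸ frattini G) a = a ↔ g * a.toMul = a.toMul * g := by
  rw [← Additive.toMul.injective.eq_iff, ← Subtype.val_injective.eq_iff, frattiniAction_mk,
    mul_inv_eq_iff_eq_mul]

/-- In a finite `2`-group all squares lie in the Frattini subgroup: a maximal subgroup `M` is
normal, and an element of order two in `G / M` generates it. -/
lemma mul_self_mem_frattini {G : Type*} [Group G] [Finite G] (hG : IsPGroup 2 G) (g : G) :
    g * g ∈ frattini G := by
  rw [frattini, Order.radical]
  simp only [Subgroup.mem_iInf]
  intro M hM
  have : Fact (Nat.Prime 2) := ⟨Nat.prime_two⟩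
  have := hG.isNilpotent
  have hN : M.Normal := Subgroup.NormalizerCondition.normal_of_coatom M
    Group.normalizerCondition_of_isNilpotent hM
  have hQ : IsPGroup 2 (G ⧸ M) := hG.to_quotient M
  have : Nontrivial (G ⧸ M) := by
    rw [QuotientGroup.nontrivial_iff]
    exact hM.1
  obtain ⟨n, hn, hcard⟩ := hQ.nontrivial_iff_card.1 this
  obtain ⟨c, hc⟩ := exists_prime_orderOf_dvd_card' (G := G ⧸ M) 2
    (hcard ▸ dvd_pow_self 2 hn.ne')
  have hc1 : c ≠ 1 := fun h => by simp [h] at hc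
  have htop : (Subgroup.zpowers c).comap (QuotientGroup.mk' M) = ⊤ := by
    refine hM.2 _ (lt_of_le_of_ne (fun m hm => ?_) fun hEq => hc1 ?_)
    · rw [Subgroup.mem_comap, QuotientGroup.mk'_apply, (QuotientGroup.eq_one_iff m).2 hm]
      exact one_mem _
    · obtain ⟨u, rfl⟩ := QuotientGroup.mk'_surjective M c
      have : u ∈ (Subgroup.zpowers (QuotientGroup.mk' M u)).comap (QuotientGroup.mk' M) :=
        Subgroup.mem_zpowers _
      rw [← hEq] at this
      exact (QuotientGroup.eq_one_iff u).2 this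
  have hg : QuotientGroup.mk' M g ∈ Subgroup.zpowers c := by
    have : g ∈ (Subgroup.zpowers c).comap (QuotientGroup.mk' M) := htop ▸ Subgroup.mem_top g
    exact this
  obtain ⟨k, hk⟩ := Subgroup.mem_zpowers_iff.1 hg
  rw [← QuotientGroup.eq_one_iff]
  change QuotientGroup.mk' M g * QuotientGroup.mk' M g = 1
  have hcc : c * c = 1 := by rw [← pow_two, ← hc, pow_orderOf_eq_one]
  rw [← hk, ← (Commute.refl c).mul_zpow, hcc, one_zpow]

lemma mem_fixedBy_frattiniAction_top {G : Type*} [Group G]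
    {a : Additive (frattiniCenter G)} :
    a ∈ fixedBy (frattiniAction G) ⊤ ↔ (a.toMul : G) ∈ Subgroup.center G := by
  rw [mem_fixedBy, Subgroup.mem_center_iff]
  constructor
  · exact fun h g => frattiniAction_mk_eq_iff.1 (h g (Subgroup.mem_top _))
  · intro h q _
    obtain ⟨g, rfl⟩ := QuotientGroup.mk_surjective q
    exact frattiniAction_mk_eq_iff.2 (h g)

lemma quotient_mul_self_eq_one {G : Type*} [Group G] [Finite G] (hG : IsPGroup 2 G)
    (q : G ⧸ frattini G) : q * q = 1 := by
  induction q using QuotientGroup.induction_on with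
  | H g => exact (QuotientGroup.eq_one_iff _).2 (mul_self_mem_frattini hG g)

lemma IsNSGroup.invariantsAreNorms {G : Type*} [Group G] [Finite G] (hG : IsNSGroup G) :
    letI : Fintype (G ⧸ frattini G) := Fintype.ofFinite _
    InvariantsAreNorms (frattiniAction G) := by
  let _ : Fintype (G ⧸ frattini G) := Fintype.ofFinite _
  intro a ha
  obtain ⟨b, hb⟩ := exists_norm_eq_of_isZero_tateCohomology
    (Rep.of (frattiniRepresentation G)) hG.tate_eq_zero (v := a) ha
  refine ⟨b, ?_⟩
  rw [Representation.norm, LinearMap.sum_apply] at hb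
  exact hb

/-- Commuting elements that generate a finite group modulo its Frattini subgroup generate the group,
which is then commutative. -/
lemma mul_comm_of_generate_mod_frattini {G : Type*} [Group G] [Finite G] {S : Set G}
    (hS : ∀ a ∈ S, ∀ b ∈ S, a * b = b * a)
    (h : ∀ q : G ⧸ frattini G, ∃ w ∈ Subgroup.closure S, (w : G ⧸ frattini G) = q) (a b : G) :
    a * b = b * a := by
  have htop : Subgroup.closure S = ⊤ := by
    refine frattini_nongenerating ((Subgroup.eq_top_iff' _).2 fun g => ?_)
    obtain ⟨w, hw, hwg⟩ := h g
    rw [← mul_inv_cancel_left w g]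
    exact mul_mem (Subgroup.mem_sup_left hw) (Subgroup.mem_sup_right (QuotientGroup.eq.1 hwg))
  have hc := Subgroup.closure_le_centralizer_centralizer S
  have hS' : S ⊆ Subgroup.centralizer S := fun a ha =>
    Subgroup.mem_centralizer_iff.2 fun b hb => hS b hb a ha
  have hcen : Subgroup.centralizer S = ⊤ := by
    rw [eq_top_iff, ← htop, Subgroup.closure_le]
    exact hS'
  rw [hcen, htop] at hc
  exact (Subgroup.mem_centralizer_iff.1 (hc (Subgroup.mem_top b)) a (Subgroup.mem_top a))

/-- If `Φ(G)` is abelian and acyclic for the four-group `⟨x, y⟩`, then `x` and `y` lift to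
commuting elements of `G`: vanishing of `Ĥ⁰(⟨x⟩; Φ(G))` gives a lift `X` of `x` with `X² = 1`, and
vanishing of `Ĥ¹(⟨x⟩; Φ(G))` shows that a conjugate of `X` by a lift of `y` is a conjugate by an
element of `Φ(G)`. -/
lemma exists_commute_lifts {G : Type*} [Group G] [Finite G] (hG : IsPGroup 2 G)
    (hΦ : ∀ a ∈ frattini G, ∀ b ∈ frattini G, a * b = b * a) {n : ℕ}
    (hA : ∀ a : Additive (frattiniCenter G), 2 ^ n • a = 0) {x y : G ⧸ frattini G}
    (h : IsFourGroupAcyclic ⊤ (frattiniAction G x) (frattiniAction G y)) :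
    ∃ X Y : G, (X : G ⧸ frattini G) = x ∧ (Y : G ⧸ frattini G) = y ∧ X * Y = Y * X := by
  have hmem : ∀ {a : G}, a ∈ frattini G → a ∈ frattiniCenter G := fun ha =>
    mem_frattiniCenter.2 ⟨ha, fun b hb => hΦ b hb _ ha⟩
  obtain ⟨u, rfl⟩ := QuotientGroup.mk_surjective x
  obtain ⟨Y, rfl⟩ := QuotientGroup.mk_surjective y
  have h0 := h.fixedAreNorms hA
  obtain ⟨b, -, hb⟩ := h0 (Additive.ofMul ⟨u * u, hmem (mul_self_mem_frattini hG u)⟩) trivial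
    (frattiniAction_mk_eq_iff.2 (mul_assoc u u u).symm)
  have hb' : (b.toMul : G) * (u * b.toMul * u⁻¹) = u * u :=
    congrArg (fun c : Additive (frattiniCenter G) => (c.toMul : G)) hb
  obtain ⟨X, hXdef⟩ : ∃ X : G, X = (b.toMul : G)⁻¹ * u := ⟨_, rfl⟩
  have hXu : (X : G ⧸ frattini G) = u := by
    rw [hXdef, QuotientGroup.eq]
    have : ((b.toMul : G)⁻¹ * u)⁻¹ * u = u⁻¹ * b.toMul * u⁻¹⁻¹ := by group
    rw [this]
    exact (inferInstance : (frattini G).Normal).conj_mem _ (mem_frattiniCenter.1 b.toMul.2).1 _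
  have hXX : X * X = 1 := by
    have h1 : u * (b.toMul : G) * u⁻¹ = (b.toMul : G)⁻¹ * (u * u) := by
      rw [← hb', inv_mul_cancel_left]
    have h2 : u * (b.toMul : G)⁻¹ * u⁻¹ = (u * u)⁻¹ * b.toMul := by
      rw [← inv_inj, mul_inv_rev, mul_inv_rev, mul_inv_rev, inv_inv, inv_inv, inv_inv, ← mul_assoc,
        h1]
    have h3 : X * X = (b.toMul : G)⁻¹ * (u * (b.toMul : G)⁻¹ * u⁻¹) * (u * u) := by
      rw [hXdef]
      group
    have h4 : (u * u)⁻¹ * (b.toMul : G) = b.toMul * (u * u)⁻¹ :=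
      hΦ _ (inv_mem (mul_self_mem_frattini hG u)) _ (mem_frattiniCenter.1 b.toMul.2).1
    rw [h3, h2, h4]
    group
  have hc : Y * X * Y⁻¹ * X⁻¹ ∈ frattini G := by
    rw [← QuotientGroup.eq_one_iff]
    have := mul_comm_of_forall_mul_self_eq_one (quotient_mul_self_eq_one hG) (Y : G ⧸ frattini G) X
    rw [QuotientGroup.mk_mul, QuotientGroup.mk_mul, QuotientGroup.mk_mul, this,
      QuotientGroup.mk_inv, QuotientGroup.mk_inv, mul_inv_cancel_right, mul_inv_cancel]
  have hcN : (Y * X * Y⁻¹ * X⁻¹) * (X * (Y * X * Y⁻¹ * X⁻¹) * X⁻¹) = 1 := by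
    have : (Y * X * Y⁻¹ * X⁻¹) * (X * (Y * X * Y⁻¹ * X⁻¹) * X⁻¹)
        = Y * (X * X) * Y⁻¹ * (X * X)⁻¹ := by group
    rw [this, hXX]
    group
  rw [← hXu] at h h0
  obtain ⟨d, -, hd⟩ := mem_augIn.1 (h0.mem_augIn_of_norm_eq_zero h.left_sq
    (fun _ _ => AddSubgroup.mem_top _) (b := Additive.ofMul ⟨_, hmem hc⟩) (AddSubgroup.mem_top _)
    (Additive.toMul.injective (Subtype.ext hcN)))
  have hd' : (d.toMul : G) / (X * d.toMul * X⁻¹) = Y * X * Y⁻¹ * X⁻¹ :=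
    congrArg (fun c : Additive (frattiniCenter G) => (c.toMul : G)) hd
  refine ⟨X, (d.toMul : G)⁻¹ * Y, hXu, ?_, ?_⟩
  · rw [QuotientGroup.eq]
    have : ((d.toMul : G)⁻¹ * Y)⁻¹ * Y = Y⁻¹ * d.toMul * Y⁻¹⁻¹ := by group
    rw [this]
    exact (inferInstance : (frattini G).Normal).conj_mem _ (mem_frattiniCenter.1 d.toMul.2).1 _
  · have h5 : (d.toMul : G) * X * (d.toMul : G)⁻¹ = Y * X * Y⁻¹ := by
      have h6 : (d.toMul : G) / (X * d.toMul * X⁻¹)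
          = (d.toMul : G) * X * (d.toMul : G)⁻¹ * X⁻¹ := by
        simp [div_eq_mul_inv, mul_assoc]
      rw [h6] at hd'
      exact mul_right_cancel hd'
    have h7 : X = (d.toMul : G)⁻¹ * (Y * X * Y⁻¹) * d.toMul := by
      rw [← h5]
      group
    calc X * ((d.toMul : G)⁻¹ * Y)
        = (d.toMul : G)⁻¹ * (Y * X * Y⁻¹) * d.toMul * ((d.toMul : G)⁻¹ * Y) := by rw [← h7]
      _ = (d.toMul : G)⁻¹ * Y * X := by group

/-! ### NS-groups of order `2 ^ 8` -/

section Order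

variable {G : Type*} [Group G] [Finite G]

lemma exists_card_additive_frattiniCenter (hG : IsPGroup 2 G) (hΦ : Nontrivial (frattini G)) :
    ∃ n, n ≠ 0 ∧ Nat.card (Additive (frattiniCenter G)) = 2 ^ n := by
  have : Fact (Nat.Prime 2) := ⟨Nat.prime_two⟩
  have h1 : Nontrivial (Subgroup.center (frattini G)) := (hG.to_subgroup _).center_nontrivial
  obtain ⟨n, hn, h⟩ := ((hG.to_subgroup (frattini G)).to_subgroup _).nontrivial_iff_card.1 h1
  exact ⟨n, hn.ne', (card_frattiniCenter G).trans h⟩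

lemma IsNSGroup.nontrivial_frattini (hG : IsNSGroup G) (h2 : IsPGroup 2 G) :
    Nontrivial (frattini G) := by
  rw [Subgroup.nontrivial_iff_ne_bot]
  intro hbot
  obtain ⟨a, b, hab⟩ := hG.nonabelian
  refine hab (mul_comm_of_forall_mul_self_eq_one (fun g => ?_) a b)
  have := mul_self_mem_frattini h2 g
  rwa [hbot, Subgroup.mem_bot] at this

/-- The Frattini quotient is not cyclic, because a lift of a generator would generate the group. -/
lemma IsNSGroup.not_isCyclic_quotient (hG : IsNSGroup G) : ¬ IsCyclic (G ⧸ frattini G) := by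
  intro hc
  obtain ⟨q, hq⟩ := hc.exists_generator
  obtain ⟨g, rfl⟩ := QuotientGroup.mk_surjective q
  obtain ⟨a, b, hab⟩ := hG.nonabelian
  refine hab (mul_comm_of_generate_mod_frattini (S := {g}) ?_ (fun r => ?_) a b)
  · rintro _ rfl _ rfl
    rfl
  · obtain ⟨k, hk⟩ := Subgroup.mem_zpowers_iff.1 (hq r)
    have hg : g ∈ Subgroup.closure {g} := Subgroup.subset_closure (Set.mem_singleton g)
    exact ⟨g ^ k, zpow_mem hg k, hk⟩

lemma IsNSGroup.card_quotient_frattini (hG : IsNSGroup G) (hcard : Nat.card G = 2 ^ 8) :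
    Nat.card (G ⧸ frattini G) = 4 := by
  have h2 : IsPGroup 2 G := IsPGroup.of_card hcard
  have : Fact (Nat.Prime 2) := ⟨Nat.prime_two⟩
  let _ : Fintype (G ⧸ frattini G) := Fintype.ofFinite _
  obtain ⟨n, hn, hA⟩ := exists_card_additive_frattiniCenter h2 (hG.nontrivial_frattini h2)
  obtain ⟨d, hd⟩ := IsPGroup.iff_card.1 (h2.to_quotient (frattini G))
  have hmul := Subgroup.card_eq_card_quotient_mul_card_subgroup (frattini G)
  rw [hcard, hd] at hmul
  match d, hd with
  | 0, hd =>
    have : Subsingleton (G ⧸ frattini G) := (Nat.card_eq_one_iff_unique.1 hd).1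
    exact absurd isCyclic_of_subsingleton hG.not_isCyclic_quotient
  | 1, hd => exact absurd (isCyclic_of_prime_card (p := 2) hd) hG.not_isCyclic_quotient
  | 2, hd => exact hd
  | d + 3, hd =>
    -- Here `|Z(Φ(G))| ≥ 64`, so that `|G| ≥ 8 * 64`.
    have h64 := hG.invariantsAreNorms.sixtyFour_le_card (quotient_mul_self_eq_one h2) hd hA hn
    have hle : Nat.card (Additive (frattiniCenter G)) ≤ Nat.card (frattini G) :=
      (card_frattiniCenter G).trans_le (Subgroup.card_le_card_group _)
    have h8 : 2 ^ 3 ≤ 2 ^ (d + 3) := Nat.pow_le_pow_right (by norm_num) (by omega)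
    have := Nat.mul_le_mul h8 (h64.trans hle)
    omega

/-- The Frattini subgroup of an NS-group of rank two is nonabelian: otherwise generators of the
Frattini quotient would lift to commuting generators of the group. -/
lemma IsNSGroup.exists_mul_ne_of_mem_frattini (hG : IsNSGroup G) (h2 : IsPGroup 2 G)
    (h4 : Nat.card (G ⧸ frattini G) = 4) :
    ∃ a ∈ frattini G, ∃ b ∈ frattini G, a * b ≠ b * a := by
  by_contra! hΦ
  let _ : Fintype (G ⧸ frattini G) := Fintype.ofFinite _
  obtain ⟨n, hn, hA⟩ := exists_card_additive_frattiniCenter h2 (hG.nontrivial_frattini h2)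
  have hA' : ∀ a : Additive (frattiniCenter G), 2 ^ n • a = 0 := fun a => by
    rw [← hA]
    exact card_nsmul_eq_zero'
  have hQ := quotient_mul_self_eq_one h2
  have : Nontrivial (G ⧸ frattini G) := Finite.one_lt_card_iff_nontrivial.1 (by omega)
  obtain ⟨x, hx⟩ := exists_ne (1 : G ⧸ frattini G)
  obtain ⟨y, hy, hyx, h⟩ := hG.invariantsAreNorms.exists_isFourGroupAcyclic_top hQ h4 hx
  obtain ⟨X, Y, rfl, rfl, hXY⟩ := exists_commute_lifts h2 hΦ hA' h
  obtain ⟨a, b, hab⟩ := hG.nonabelian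
  refine hab (mul_comm_of_generate_mod_frattini (S := {X, Y}) ?_ (fun q => ?_) a b)
  · rintro _ (rfl | rfl) _ (rfl | rfl)
    exacts [rfl, hXY, hXY.symm, rfl]
  · have hbij := bijective_mul_of_card_eq_four_mul hQ
      (show Nat.card (G ⧸ frattini G) = 4 * Nat.card (⊥ : Subgroup (G ⧸ frattini G)) by
        rw [Subgroup.card_bot, h4]) hx hy hyx
    obtain ⟨⟨⟨i, j⟩, ⟨k, hk⟩⟩, rfl⟩ := hbij.2 q
    obtain rfl := Subgroup.mem_bot.1 hk
    have hX : X ∈ Subgroup.closure {X, Y} := Subgroup.subset_closure (by simp)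
    have hY : Y ∈ Subgroup.closure {X, Y} := Subgroup.subset_closure (by simp)
    refine ⟨cond i Y 1 * cond j X 1, mul_mem ?_ ?_, ?_⟩
    · cases i
      exacts [one_mem _, hY]
    · cases j
      exacts [one_mem _, hX]
    · cases i <;> cases j <;> simp

/-- The action of the Frattini quotient forces `|Z(Φ(G))| ≥ 16`. As `Φ(G)` is nonabelian of order
`64`, its center has index at least four, whence `|Z(Φ(G))| ≤ 16`. -/
lemma IsNSGroup.card_frattiniCenter_eq (hG : IsNSGroup G) (hcard : Nat.card G = 2 ^ 8) :
    Nat.card (Additive (frattiniCenter G)) = 16 := by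
  have h2 : IsPGroup 2 G := IsPGroup.of_card hcard
  have : Fact (Nat.Prime 2) := ⟨Nat.prime_two⟩
  let _ : Fintype (G ⧸ frattini G) := Fintype.ofFinite _
  have h4 := hG.card_quotient_frattini hcard
  obtain ⟨n, hn, hA⟩ := exists_card_additive_frattiniCenter h2 (hG.nontrivial_frattini h2)
  have h16 := hG.invariantsAreNorms.sixteen_le_card (quotient_mul_self_eq_one h2) h4 hA hn
  have hmul := Subgroup.card_eq_card_quotient_mul_card_subgroup (frattini G)
  rw [hcard, h4] at hmul
  have hmul' := Subgroup.card_eq_card_quotient_mul_card_subgroup (Subgroup.center (frattini G))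
  rw [← card_frattiniCenter] at hmul'
  obtain ⟨d, hd⟩ := IsPGroup.iff_card.1
    ((h2.to_subgroup (frattini G)).to_quotient (Subgroup.center (frattini G)))
  have hncyc : ¬ IsCyclic (frattini G ⧸ Subgroup.center (frattini G)) := by
    intro hc
    obtain ⟨a, ha, b, hb, hab⟩ := hG.exists_mul_ne_of_mem_frattini h2 h4
    have := MonoidHom.isMulCommutative_of_isCyclic_of_ker_le_center
      (QuotientGroup.mk' (Subgroup.center (frattini G))) (by rw [QuotientGroup.ker_mk'])
    exact hab (congrArg Subtype.val (this.is_comm.comm ⟨a, ha⟩ ⟨b, hb⟩))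
  match d, hd with
  | 0, hd =>
    have : Subsingleton (frattini G ⧸ Subgroup.center (frattini G)) :=
      (Nat.card_eq_one_iff_unique.1 hd).1
    exact absurd isCyclic_of_subsingleton hncyc
  | 1, hd => exact absurd (isCyclic_of_prime_card (p := 2) hd) hncyc
  | d + 2, hd =>
    rw [hd] at hmul'
    have h8 : 2 ^ 2 ≤ 2 ^ (d + 2) := Nat.pow_le_pow_right (by norm_num) (by omega)
    have := Nat.mul_le_mul_right (Nat.card (frattiniCenter G)) h8
    change 16 ≤ Nat.card (frattiniCenter G) at h16
    change Nat.card (frattiniCenter G) = 16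
    omega

/-- As the Frattini quotient acts faithfully on `Z(Φ(G))`, the center lies in `Φ(G)`. -/
lemma IsNSGroup.center_le_frattiniCenter (hG : IsNSGroup G) (hcard : Nat.card G = 2 ^ 8) :
    Subgroup.center G ≤ frattiniCenter G := by
  have h2 : IsPGroup 2 G := IsPGroup.of_card hcard
  let _ : Fintype (G ⧸ frattini G) := Fintype.ofFinite _
  intro g hg
  rw [Subgroup.mem_center_iff] at hg
  refine mem_frattiniCenter.2 ⟨?_, fun b _ => hg b⟩
  by_contra hgΦ
  obtain ⟨a, ha⟩ := hG.invariantsAreNorms.exists_apply_ne (n := 4) (quotient_mul_self_eq_one h2)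
    (hG.card_quotient_frattini hcard) (hG.card_frattiniCenter_eq hcard) (by norm_num)
    (x := (g : G ⧸ frattini G)) (fun h => hgΦ ((QuotientGroup.eq_one_iff g).1 h))
  exact ha (frattiniAction_mk_eq_iff.2 (hg _).symm)

end Order

theorem mainTheorem4 (G : Type*) [Group G] [Finite G] (hG : IsNSGroup G)
    (hcard : Nat.card G = 2 ^ 8) :
    (Nonempty (frattiniCenter G ≃* Multiplicative (ZMod 4 × (Fin 2 → ZMod 2))) ∨
      Nonempty (frattiniCenter G ≃* Multiplicative (Fin 4 → ZMod 2))) ∧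
    Subgroup.center G ≤ frattiniCenter G ∧
    Nonempty ((frattiniCenter G ⧸ (Subgroup.center G).subgroupOf (frattiniCenter G)) ≃*
      Multiplicative (Fin 3 → ZMod 2)) := by
  have h2 : IsPGroup 2 G := IsPGroup.of_card hcard
  let _ : Fintype (G ⧸ frattini G) := Fintype.ofFinite _
  have hQ := quotient_mul_self_eq_one h2
  have h4 := hG.card_quotient_frattini hcard
  have h16 := hG.card_frattiniCenter_eq hcard
  have hZ := hG.invariantsAreNorms.card_fixedBy_top hQ h4 h16
  have htwo := hG.invariantsAreNorms.two_nsmul_mem_fixedBy_top hQ h4 h16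
  refine ⟨?_, hG.center_le_frattiniCenter hcard, ?_⟩
  · exact (nonempty_addEquiv_of_two_nsmul_mem h16 hZ htwo).imp
      (fun ⟨e⟩ => ⟨AddEquiv.toMultiplicativeRight e⟩)
      (fun ⟨e⟩ => ⟨AddEquiv.toMultiplicativeRight e⟩)
  · refine nonempty_mulEquiv_pi_zmod_two (fun b => ?_) ?_
    · induction b using QuotientGroup.induction_on with
      | H a =>
        refine (QuotientGroup.eq_one_iff _).2 ?_
        have := mem_fixedBy_frattiniAction_top.1 (htwo (Additive.ofMul a))
        rw [two_nsmul] at this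
        exact this
    · have hZ' : Nat.card ((Subgroup.center G).subgroupOf (frattiniCenter G)) = 2 := by
        rw [← hZ]
        exact Nat.card_congr ⟨fun a => ⟨Additive.ofMul a.1, mem_fixedBy_frattiniAction_top.2 a.2⟩,
          fun a => ⟨a.1.toMul, mem_fixedBy_frattiniAction_top.1 a.2⟩, fun _ => rfl, fun _ => rfl⟩
      have hmul := Subgroup.card_eq_card_quotient_mul_card_subgroup
        ((Subgroup.center G).subgroupOf (frattiniCenter G))
      change Nat.card (frattiniCenter G) = 16 at h16
      rw [hZ', h16] at hmul
      omega
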